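/- Let $W\subset O(\mathbb R^n)$, $n\ge 1$, be a finite group generated by reflections in hyperplanes that acts essentially (only the origin is fixed by all of $W$) and irreducibly on $\mathbb R^n$. An integrity basis of $W$ is a family $p_1,\dots,p_n$ of algebraically independent homogeneous polynomials generating the algebra of $W$-invariant real polynomials, listed so that the degrees $k_1\le\dots\le k_n$ are nondecreasing; put $h=k_n$ (the Coxeter number of $W$) and $P=(p_1,\dots,p_n):\mathbb R^n\to\mathbb R^n$. Assume that $h$ is even; by the classification of finite Coxeter groups this holds for every irreducible $W$ except those of type $A_{2m}$ and $I_2(2m+1)$, $m\ge 1$. 1. There is an integrity basis $p_1,\dots,p_n$ of $W$ with $p_n=\sum_{L\in S}L^{h}$, where $S$ is a finite $W$-invariant set of linear forms whose kernels intersect only at the origin; in particular $p_n(x)>0$ for all $x\ne 0$. 2. Let $p_1,\dots,p_n$ be any integrity basis of $W$ with $p_n(x)>0$ for all $x\neq 0$, let $s\ge 0$ be an integer and $0<\alpha<1/h$. Put $F(y)=|y_n|^{s+\alpha}$ for $y\in\mathbb R^n$, and $f=F\circ P$. Then: (a) $F$ is of class $\mathcal C^s$ on $\mathbb R^n$, but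 is not of class $\mathcal C^{s+1}$ in a neighbourhood of any point $y$ with $y_n=0$; (b) $f=p_n^{\,s+\alpha}$ is $W$-invariant and of class $\mathcal C^{hs}$ on $\mathbb R^n$, but is not of class $\mathcal C^{hs+1}$ in any neighbourhood of the origin; (c) for every integrity basis $q_1,\dots,q_n$ of $W$, with $Q=(q_1,\dots,q_n)$, there is no function $G:\mathbb R^n\to\mathbb R$ of class $\mathcal C^{s+1}$ such that $f=G\circ Q$. Hence the loss of differentiability in the theorem that every $W$-invariant $f$ of class $\mathcal C^{r}$ can be written $f=F\circ P$ with $F$ of class $\mathcal C^{\lfloor r/h\rfloor}$ cannot be reduced. -/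

import Mathlib

/-- Euclidean space of dimension `m`. -/
abbrev Euc (m : ℕ) : Type := EuclideanSpace ℝ (Fin m)

/-- An orthogonal transformation which is the reflection in a hyperplane. -/
def IsHyperplaneReflection {m : ℕ} (g : Euc m ≃ₗᵢ[ℝ] Euc m) : Prop :=
  ∃ v : Euc m, v ≠ 0 ∧ g = (Submodule.span ℝ {v})ᗮ.reflection

/-- A finite group of orthogonal transformations generated by the reflections it contains, which
acts essentially (only the origin is fixed by the whole group) and irreducibly. -/
structure IsIrreducibleReflectionGroup {m : ℕ} (W : Subgroup (Euc m ≃ₗᵢ[ℝ] Euc m)) : Prop where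
  finite : Finite W
  generated : Subgroup.closure {g | g ∈ W ∧ IsHyperplaneReflection g} = W
  essential : ∀ x : Euc m, (∀ g ∈ W, g x = x) → x = 0
  irreducible : ∀ V : Submodule ℝ (Euc m), (∀ g ∈ W, ∀ x ∈ V, g x ∈ V) → V = ⊥ ∨ V = ⊤

/-- The algebra of `W`-invariant real polynomials. -/
def invariantPolynomials {m : ℕ} (W : Subgroup (Euc m ≃ₗᵢ[ℝ] Euc m)) :
    Subalgebra ℝ (MvPolynomial (Fin m) ℝ) where
  carrier := {q | ∀ g ∈ W, ∀ x : Euc m, MvPolynomial.eval (g x) q = MvPolynomial.eval x q}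
  mul_mem' := by
    intro a b ha hb g hg x
    rw [map_mul, map_mul, ha g hg x, hb g hg x]
  add_mem' := by
    intro a b ha hb g hg x
    rw [map_add, map_add, ha g hg x, hb g hg x]
  algebraMap_mem' := by
    intro r g _ x
    simp [MvPolynomial.algebraMap_eq]

/-- `p` is an integrity basis of the algebra of `W`-invariant polynomials: homogeneous,
algebraically independent generators, listed with nondecreasing degrees `k`. -/
structure IsIntegrityBasis {m : ℕ} (W : Subgroup (Euc m ≃ₗᵢ[ℝ] Euc m)) (k : Fin m → ℕ)
    (p : Fin m → MvPolynomial (Fin m) ℝ) : Prop where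
  homogeneous : ∀ i, (p i).IsHomogeneous (k i)
  monotone : Monotone k
  algebraicIndependent : AlgebraicIndependent ℝ p
  adjoin_eq : Algebra.adjoin ℝ (Set.range p) = invariantPolynomials W

/-- The Chevalley mapping `x ↦ (p₁(x), …, p_m(x))`. -/
noncomputable def chevalleyMap {m : ℕ} (p : Fin m → MvPolynomial (Fin m) ℝ) (x : Euc m) : Euc m :=
  WithLp.toLp 2 (fun i => MvPolynomial.eval x (p i))

/-- The function `y ↦ |y_last| ^ β`. -/
noncomputable def absLastPow {n : ℕ} (β : ℝ) (y : Euc (n + 1)) : ℝ :=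
  |y (Fin.last n)| ^ β

/-!
Both parts rest on the weights of an integrity basis `p`: a homogeneous invariant `u` of degree
`k i` is a polynomial `A(p)` which is homogeneous for the weights `k`, and as these are positive,
`A = c X i + B` where `B` does not involve `X i`
(`MvPolynomial.IsWeightedHomogeneous.exists_eq_C_mul_X_add`).

*A sum of powers of linear forms.* If `c ≠ 0`, then `u` may replace `p i` in the basis
(`IsIntegrityBasis.update`). As `u` take the sum of the `k i`-th powers over the orbit of a linear
form `L`. For some `L` the coefficient `c` does not vanish: it is, up to a nonzero factor, the value
at `L ^ k i` of a linear functional which is not zero at `p i`, while the powers of linear forms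
span the homogeneous polynomials (`exists_linearPolynomial_pow_ne_zero`). By irreducibility the
common kernel of the forms in the orbit is `0`, so for an even degree the sum is positive off the
origin.

*Smoothness.* Both `|t| ^ β` and `p_n ^ β` are smooth off the origin and positively homogeneous, of
degrees `β` and `h β`. Such a function is `C^r` as soon as its degree exceeds `r`
(`contDiff_of_posHomogeneous`).

*Lack of smoothness.* All three negative assertions come from
`not_contDiffAt_of_eqOn_mul_rpow`: differentiating `A ^ (s + α)` a total of `s + 1` times along a
direction in which `A` has constant slope `c ≠ 0` yields a nonzero multiple of `A ^ (α - 1)`, which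
is unbounded near the zeros of `A`. For a lift `G` of `p_n ^ (s + α)` through another basis `q`,
write `p_n = A(q)`. Then `A` contains some variable linearly, since otherwise `p_n`, rewritten in
terms of `p`, would have no linear term
(`IsIntegrityBasis.exists_aeval_eq_coeff_ne_zero`); and `G = A ^ (s + α)` on the image of
`Q = (q_1, …, q_n)`. This image has interior points arbitrarily close to the origin, since `Q` is a
submersion at every point `x₀` with trivial stabilizer: the differentials of the invariants at `x₀`
have no common zero but `0` (`exists_invariant_fderiv_ne_zero`).
-/

universe u

/-! ### Homogeneous functions and their smoothness at the origin -/

/-- A positively homogeneous function of degree `β`, continuous off the origin, is bounded by a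
multiple of `‖x‖ ^ β`. -/
theorem exists_norm_le_mul_rpow_of_posHomogeneous {E F : Type*} [NormedAddCommGroup E]
    [NormedSpace ℝ E] [FiniteDimensional ℝ E] [NormedAddCommGroup F] [NormedSpace ℝ F]
    {f : E → F} {β : ℝ} (hβ : 0 < β) (hcont : ∀ x, x ≠ 0 → ContinuousAt f x)
    (hhom : ∀ t : ℝ, 0 < t → ∀ x, f (t • x) = t ^ β • f x) :
    ∃ C, ∀ x, ‖f x‖ ≤ C * ‖x‖ ^ β := by
  have h0 : f 0 = 0 := by
    have h := hhom 2 two_pos 0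
    rw [smul_zero] at h
    have h2 : (1 : ℝ) < 2 ^ β := Real.one_lt_rpow (by norm_num) hβ
    have h3 : ((2 : ℝ) ^ β - 1) • f 0 = 0 := by rw [sub_smul, ← h, one_smul, sub_self]
    exact (smul_eq_zero.1 h3).resolve_left (by linarith)
  have hprop : ProperSpace E := FiniteDimensional.proper_real E
  obtain ⟨C, hC⟩ := (isCompact_sphere (0 : E) 1).exists_bound_of_continuousOn (f := f)
    (fun x hx => (hcont x (by rintro rfl; simp at hx)).continuousWithinAt)
  refine ⟨C, fun x => ?_⟩
  rcases eq_or_ne x 0 with rfl | hx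
  · simp [h0, Real.zero_rpow hβ.ne']
  · have hx' : 0 < ‖x‖ := norm_pos_iff.2 hx
    have h1 : x = ‖x‖ • (‖x‖⁻¹ • x) := by rw [smul_smul, mul_inv_cancel₀ hx'.ne', one_smul]
    have h2 : ‖f (‖x‖⁻¹ • x)‖ ≤ C := by
      apply hC
      simp [norm_smul, inv_mul_cancel₀ hx'.ne']
    calc ‖f x‖ = ‖x‖ ^ β * ‖f (‖x‖⁻¹ • x)‖ := by
          conv_lhs => rw [h1, hhom _ hx', norm_smul, Real.norm_of_nonneg (by positivity)]
      _ ≤ ‖x‖ ^ β * C := by gcongr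
      _ = C * ‖x‖ ^ β := mul_comm _ _

/-- A function on a finite-dimensional space which is smooth off the origin and positively
homogeneous of real degree `β > m` is of class `C^m`. The derivative is homogeneous of degree
`β - 1`, so this follows by induction on `m`. -/
theorem contDiff_of_posHomogeneous {E : Type u} {F : Type u} [NormedAddCommGroup E]
    [NormedSpace ℝ E] [FiniteDimensional ℝ E] [NormedAddCommGroup F] [NormedSpace ℝ F] (m : ℕ)
    {f : E → F} {β : ℝ} (hβ : (m : ℝ) < β)
    (hsmooth : ∀ x, x ≠ 0 → ∀ j : ℕ, ContDiffAt ℝ j f x)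
    (hhom : ∀ t : ℝ, 0 < t → ∀ x, f (t • x) = t ^ β • f x) : ContDiff ℝ m f := by
  have hβ0 : 0 < β := lt_of_le_of_lt (Nat.cast_nonneg m) hβ
  obtain ⟨C, hC⟩ := exists_norm_le_mul_rpow_of_posHomogeneous hβ0
    (fun x hx => (hsmooth x hx 0).continuousAt) hhom
  have h0 : f 0 = 0 := by simpa [Real.zero_rpow hβ0.ne'] using hC 0
  induction m generalizing F β C with
  | zero =>
    refine contDiff_zero.2 (continuous_iff_continuousAt.2 fun x => ?_)
    rcases eq_or_ne x 0 with rfl | hx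
    · rw [ContinuousAt, h0]
      refine squeeze_zero_norm hC ?_
      have h : Continuous fun x : E => C * ‖x‖ ^ β :=
        continuous_const.mul (continuous_norm.rpow_const fun _ => Or.inr hβ0.le)
      simpa [Real.zero_rpow hβ0.ne'] using h.tendsto 0
    · exact (hsmooth x hx 0).continuousAt
  | succ m ih =>
    have hβ1 : (m : ℝ) < β - 1 := by push_cast at hβ; linarith
    have hβ1' : 0 < β - 1 := lt_of_le_of_lt (Nat.cast_nonneg m) hβ1
    have hdiff : Differentiable ℝ f := by
      intro x
      rcases eq_or_ne x 0 with rfl | hx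
      · refine HasFDerivAt.differentiableAt (f' := 0) ?_
        rw [hasFDerivAt_iff_tendsto]
        have h : Continuous fun x : E => C * ‖x‖ ^ (β - 1) :=
          continuous_const.mul (continuous_norm.rpow_const fun _ => Or.inr hβ1'.le)
        have h' := h.tendsto 0
        rw [norm_zero, Real.zero_rpow hβ1'.ne', mul_zero] at h'
        refine squeeze_zero (fun x => by positivity) (fun x => ?_) h'
        rcases eq_or_ne x 0 with rfl | hx
        · simp [Real.zero_rpow hβ1'.ne']
        · have hx' : 0 < ‖x‖ := norm_pos_iff.2 hx
          simp only [sub_zero, h0, zero_apply]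
          rw [Real.rpow_sub_one hx'.ne', inv_mul_le_iff₀ hx']
          calc ‖f x‖ ≤ C * ‖x‖ ^ β := hC x
            _ = ‖x‖ * (C * (‖x‖ ^ β / ‖x‖)) := by field_simp
      · exact (hsmooth x hx 1).differentiableAt (by simp)
    have hfd : ∀ t : ℝ, 0 < t → ∀ x, fderiv ℝ f (t • x) = t ^ (β - 1) • fderiv ℝ f x := by
      intro t ht x
      have h1 : fderiv ℝ (fun y => f (t • y)) x = t ^ β • fderiv ℝ f x := by
        rw [show (fun y => f (t • y)) = t ^ β • f from _root_.funext (hhom t ht),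
          fderiv_const_smul (hdiff x)]
      rw [fderiv_comp_smul] at h1
      rw [Real.rpow_sub_one ht.ne', div_eq_inv_mul, mul_smul, ← h1, smul_smul,
        inv_mul_cancel₀ ht.ne', one_smul]
    have hsm : ∀ x, x ≠ 0 → ∀ j : ℕ, ContDiffAt ℝ j (fderiv ℝ f) x := fun x hx j =>
      (hsmooth x hx (j + 1)).fderiv_right (by push_cast; exact le_rfl)
    obtain ⟨C', hC'⟩ := exists_norm_le_mul_rpow_of_posHomogeneous hβ1'
      (fun x hx => (hsm x hx 0).continuousAt) hfd
    have hind : ContDiff ℝ m (fderiv ℝ f) := ih hβ1 hsm hfd hβ1' C' hC'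
      (by simpa [Real.zero_rpow hβ1'.ne'] using hC' 0)
    have := contDiff_succ_iff_fderiv.2 ⟨hdiff, by simp, hind⟩
    simpa using this

/-! ### Real powers of functions which are affine along a direction -/

/-- The obstruction to differentiability: a function equal to `K * A ^ β` on an open set `U`, where
`A` is positive on `U` and has nonzero constant slope `c` in some direction `e`, is not `C^m` at a
limit point of `U` at which `A` vanishes, if `β < m` and `β ∉ {0, …, m - 1}`. Differentiating `m`
times along `e` gives a nonzero multiple of `A ^ (β - m)`, which is unbounded. -/
theorem not_contDiffAt_of_eqOn_mul_rpow {E : Type*} [NormedAddCommGroup E] [NormedSpace ℝ E]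
    (m : ℕ) {G A : E → ℝ} {U : Set E} {y₀ e : E} {K c β : ℝ} (hU : IsOpen U)
    (hy₀ : y₀ ∈ closure U) (hA : ContinuousAt A y₀) (hA0 : A y₀ = 0)
    (hline : ∀ y, ∀ t : ℝ, A (y + t • e) = A y + c * t) (hpos : ∀ y ∈ U, 0 < A y)
    (hG : ∀ y ∈ U, G y = K * A y ^ β) (hK : K ≠ 0) (hc : c ≠ 0) (hβm : β < m)
    (hβ : ∀ j : ℕ, j < m → β ≠ j) : ¬ ContDiffAt ℝ m G y₀ := by
  induction m generalizing G U K β with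
  | zero =>
    intro hcd
    have hβ0 : β < 0 := by simpa using hβm
    have hne : (nhdsWithin y₀ U).NeBot := mem_closure_iff_nhdsWithin_neBot.1 hy₀
    have hGt : Filter.Tendsto G (nhdsWithin y₀ U) (nhds (G y₀)) :=
      hcd.continuousAt.tendsto.mono_left nhdsWithin_le_nhds
    have hAt : Filter.Tendsto A (nhdsWithin y₀ U) (nhds 0) := by
      rw [← hA0]; exact hA.tendsto.mono_left nhdsWithin_le_nhds
    -- the product `G * A ^ (-β)` tends to `0` and is equal to `K` on `U`
    have h1 : Filter.Tendsto (fun y => G y * A y ^ (-β)) (nhdsWithin y₀ U) (nhds 0) := by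
      have h2 := hAt.rpow_const (p := -β) (Or.inr (by linarith))
      rw [Real.zero_rpow (by linarith)] at h2
      simpa using hGt.mul h2
    have h3 : Filter.Tendsto (fun y => G y * A y ^ (-β)) (nhdsWithin y₀ U) (nhds K) := by
      refine tendsto_const_nhds.congr' ?_
      filter_upwards [self_mem_nhdsWithin] with y hy
      rw [hG y hy, mul_assoc, ← Real.rpow_add (hpos y hy)]
      simp
    exact hK (tendsto_nhds_unique h3 h1)
  | succ m ih =>
    intro hcd
    have hD : ContDiffAt ℝ m (fun y => fderiv ℝ G y e) y₀ :=
      (hcd.fderiv_right (m := (m : WithTop ℕ∞)) (by push_cast; exact le_rfl)).clm_apply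
        contDiffAt_const
    have hdiff : ∀ᶠ y in nhds y₀, DifferentiableAt ℝ G y := by
      have h1 : ContDiffAt ℝ 1 G y₀ := hcd.of_le (by push_cast; exact le_add_self)
      filter_upwards [h1.eventually (by simp)] with y hy
      exact hy.differentiableAt (by simp)
    obtain ⟨V, hV, hVo, hyV⟩ := eventually_nhds_iff.1 hdiff
    have hβ0 : β ≠ 0 := by simpa using hβ 0 (Nat.succ_pos m)
    refine ih (U := U ∩ V) (hU.inter hVo) ?_ (fun y hy => hpos y hy.1) (K := K * (β * c))
      (β := β - 1) ?_ ?_ ?_ ?_ hD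
    · rw [mem_closure_iff_nhdsWithin_neBot, nhdsWithin_inter_of_mem'
        (mem_nhdsWithin_of_mem_nhds (hVo.mem_nhds hyV))]
      exact mem_closure_iff_nhdsWithin_neBot.1 hy₀
    · rintro y ⟨hyU, hyV⟩
      have hl : HasDerivAt (fun t : ℝ => y + t • e) e 0 := by
        simpa using ((hasDerivAt_id (0 : ℝ)).smul_const e).const_add y
      have hd1 : HasDerivAt (fun t : ℝ => G (y + t • e)) (fderiv ℝ G y e) 0 := by
        have h : HasFDerivAt G (fderiv ℝ G y) (y + (0 : ℝ) • e) := by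
          simpa using (hV y hyV).hasFDerivAt
        exact h.comp_hasDerivAt (0 : ℝ) hl
      have hd2 : HasDerivAt (fun t : ℝ => K * (A y + c * t) ^ β)
          (K * (c * β * A y ^ (β - 1))) 0 := by
        have h : HasDerivAt (fun t : ℝ => A y + c * t) c 0 := by
          simpa using ((hasDerivAt_id (0 : ℝ)).const_mul c).const_add (A y)
        simpa using (h.rpow_const (p := β) (Or.inl (by simpa using (hpos y hyU).ne'))).const_mul K
      have heq : (fun t : ℝ => G (y + t • e)) =ᶠ[nhds 0] fun t => K * (A y + c * t) ^ β := by
        have hmem : ∀ᶠ t : ℝ in nhds 0, y + t • e ∈ U :=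
          hl.continuousAt.eventually_mem (hU.mem_nhds (by simpa using hyU))
        filter_upwards [hmem] with t ht
        rw [hG _ ht, hline]
      rw [hd1.unique (hd2.congr_of_eventuallyEq heq)]
      ring
    · exact mul_ne_zero hK (mul_ne_zero hβ0 hc)
    · push_cast at hβm; linarith
    · intro j hj h
      exact hβ (j + 1) (by omega) (by push_cast; linarith)

/-! ### Weighted homogeneous expressions in an integrity basis -/

namespace MvPolynomial

/-- Substituting homogeneous polynomials of degrees `k i` into a polynomial which is homogeneous of
weighted degree `d` for the weights `k` gives a homogeneous polynomial of degree `d`. -/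
theorem IsWeightedHomogeneous.aeval_isHomogeneous {σ τ R : Type*} [CommSemiring R] {k : σ → ℕ}
    {p : σ → MvPolynomial τ R} (hp : ∀ i, (p i).IsHomogeneous (k i)) {A : MvPolynomial σ R} {d : ℕ}
    (hA : IsWeightedHomogeneous k A d) : (aeval p A).IsHomogeneous d := by
  rw [aeval_def, eval₂_eq]
  refine IsHomogeneous.sum _ _ _ fun m hm => ?_
  have h1 : (∏ i ∈ m.support, p i ^ m i).IsHomogeneous (∑ i ∈ m.support, k i * m i) :=
    IsHomogeneous.prod _ _ _ fun i _ => (hp i).pow (m i)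
  have h2 : ∑ i ∈ m.support, k i * m i = d := by
    rw [← hA (mem_support_iff.1 hm), Finsupp.weight_apply, Finsupp.sum]
    exact Finset.sum_congr rfl fun i _ => by rw [smul_eq_mul, mul_comm]
  rw [← h2, ← zero_add (∑ i ∈ m.support, k i * m i)]
  exact (isHomogeneous_C _ _).mul h1

theorem homogeneousComponent_aeval {σ τ R : Type*} [CommSemiring R] {k : σ → ℕ}
    {p : σ → MvPolynomial τ R} (hp : ∀ i, (p i).IsHomogeneous (k i)) (A : MvPolynomial σ R)
    (d : ℕ) :
    homogeneousComponent d (aeval p A) = aeval p (weightedHomogeneousComponent k d A) := by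
  induction A using MvPolynomial.induction_on' with
  | monomial m a =>
    have h := isWeightedHomogeneous_monomial k m a rfl
    have h' := h.aeval_isHomogeneous hp
    rw [weightedHomogeneousComponent_of_mem h, homogeneousComponent_of_mem h']
    split_ifs <;> simp
  | add a b ha hb => simp only [map_add, ha, hb]

/-- In a weighted homogeneous polynomial of weighted degree `k i`, with positive weights, the only
monomial containing `X i` is `X i` itself. -/
theorem IsWeightedHomogeneous.exists_eq_C_mul_X_add {σ R : Type*} [CommRing R] {k : σ → ℕ}
    (hk : ∀ i, 0 < k i) {A : MvPolynomial σ R} {i : σ} (hA : IsWeightedHomogeneous k A (k i)) :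
    ∃ B : MvPolynomial σ R, i ∉ B.vars ∧ A = C (coeff (Finsupp.single i 1) A) * X i + B := by
  classical
  refine ⟨A - C (coeff (Finsupp.single i 1) A) * X i, ?_, by ring⟩
  rw [mem_vars_iff_mem_support]
  rintro ⟨m, hm, him⟩
  rw [mem_support_iff, coeff_sub, coeff_C_mul, coeff_X] at hm
  by_cases hmi : Finsupp.single i 1 = m
  · rw [if_pos hmi, ← hmi] at hm
    simp at hm
  · rw [if_neg hmi, mul_zero, sub_zero] at hm
    have hle : Finsupp.single i 1 ≤ m := by
      rw [Finsupp.single_le_iff]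
      exact Nat.one_le_iff_ne_zero.2 (Finsupp.mem_support_iff.1 him)
    obtain ⟨m', rfl⟩ := exists_add_of_le hle
    have hw := hA hm
    rw [map_add, Finsupp.weight_single, one_smul] at hw
    have hw' : Finsupp.weight k m' = 0 := by omega
    apply hmi
    suffices m' = 0 by simp [this]
    ext j
    by_contra hj
    have := Finsupp.le_weight_of_ne_zero' k hj
    have := hk j
    omega

theorem eval_add_single_of_notMem_vars {m : ℕ} {B : MvPolynomial (Fin m) ℝ} {i : Fin m}
    (hi : i ∉ B.vars) (y : Euc m) (t : ℝ) :
    eval (y + t • EuclideanSpace.single i (1 : ℝ)) B = eval y B := by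
  refine hom_congr_vars (by ext; simp) (fun j hj _ => ?_) rfl
  have hji : j ≠ i := fun h => hi (h ▸ hj)
  simp [hji]

/-- The chain rule for a derivation of a polynomial algebra applied to a substitution. -/
theorem derivation_aeval {σ τ R : Type*} [Fintype σ] [CommRing R]
    (D : Derivation R (MvPolynomial τ R) (MvPolynomial τ R)) (B : σ → MvPolynomial τ R)
    (A : MvPolynomial σ R) : D (aeval B A) = ∑ i, aeval B (pderiv i A) * D (B i) := by
  classical
  induction A using MvPolynomial.induction_on with
  | C a => simp
  | add a b ha hb => simp only [map_add, ha, hb, add_mul, Finset.sum_add_distrib]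
  | mul_X a j ha =>
    simp only [map_mul, aeval_X, Derivation.leibniz, smul_eq_mul, ha, map_add, pderiv_X, add_mul,
      Finset.sum_add_distrib, Finset.mul_sum]
    congr 1
    · rw [Finset.sum_eq_single j]
      · simp
      · intro i _ hij; simp [Pi.single_eq_of_ne hij.symm]
      · simp
    · exact Finset.sum_congr rfl fun i _ => by ring

theorem constantCoeff_pderiv {σ R : Type*} [CommSemiring R] (i : σ) (A : MvPolynomial σ R) :
    constantCoeff (pderiv i A) = coeff (Finsupp.single i 1) A := by
  rw [constantCoeff_eq, coeff_pderiv]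
  simp

end MvPolynomial

open MvPolynomial in
theorem eval_chevalleyMap (p : Fin m → MvPolynomial (Fin m) ℝ) (A : MvPolynomial (Fin m) ℝ)
    (x : Euc m) : eval (chevalleyMap p x) A = eval x (aeval p A) := by
  have h : (eval (chevalleyMap p x) : MvPolynomial (Fin m) ℝ →+* ℝ) =
      (eval (x : Fin m → ℝ)).comp (aeval p : _ →ₐ[ℝ] MvPolynomial (Fin m) ℝ).toRingHom := by
    ext i
    · simp
    · simp [chevalleyMap]
  exact RingHom.congr_fun h A

namespace IsIntegrityBasis

open MvPolynomial

variable {m : ℕ} {W : Subgroup (Euc m ≃ₗᵢ[ℝ] Euc m)} {k k' : Fin m → ℕ}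
  {p q : Fin m → MvPolynomial (Fin m) ℝ}

theorem degree_pos (hp : IsIntegrityBasis W k p) (i : Fin m) : 0 < k i := by
  rw [Nat.pos_iff_ne_zero]
  intro h
  have h1 := hp.homogeneous i
  rw [h] at h1
  have h2 := totalDegree_eq_zero_iff_eq_C.1 (Nat.le_zero.1 h1.totalDegree_le)
  refine hp.algebraicIndependent.transcendental i ?_
  rw [h2, ← algebraMap_eq]
  exact isAlgebraic_algebraMap _

theorem mem_invariantPolynomials (hp : IsIntegrityBasis W k p) (i : Fin m) :
    p i ∈ invariantPolynomials W := by
  rw [← hp.adjoin_eq]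
  exact Algebra.subset_adjoin ⟨i, rfl⟩

/-- A homogeneous invariant is a weighted homogeneous polynomial in the integrity basis. -/
theorem exists_aeval_eq (hp : IsIntegrityBasis W k p) {u : MvPolynomial (Fin m) ℝ} {d : ℕ}
    (hu : u ∈ invariantPolynomials W) (hd : u.IsHomogeneous d) :
    ∃ A : MvPolynomial (Fin m) ℝ, IsWeightedHomogeneous k A d ∧ aeval p A = u := by
  rw [← hp.adjoin_eq, Algebra.adjoin_range_eq_range_aeval] at hu
  obtain ⟨A, rfl⟩ := hu
  refine ⟨weightedHomogeneousComponent k d A,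
    weightedHomogeneousComponent_isWeightedHomogeneous d A, ?_⟩
  rw [← homogeneousComponent_aeval hp.homogeneous]
  exact (homogeneousComponent_of_mem hd).trans (if_pos rfl)

/-- Expressed in another integrity basis `q`, a member `p l` of an integrity basis contains some
`q i` linearly: otherwise `p l`, rewritten in terms of `p`, would have no linear term. -/
theorem exists_aeval_eq_coeff_ne_zero (hp : IsIntegrityBasis W k p) (hq : IsIntegrityBasis W k' q)
    (l : Fin m) : ∃ (i : Fin m) (A : MvPolynomial (Fin m) ℝ), aeval q A = p l ∧
      IsWeightedHomogeneous k' A (k' i) ∧ coeff (Finsupp.single i 1) A ≠ 0 := by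
  obtain ⟨A, hA, hAq⟩ := hq.exists_aeval_eq (hp.mem_invariantPolynomials l) (hp.homogeneous l)
  choose B hB hBp using fun j =>
    hp.exists_aeval_eq (hq.mem_invariantPolynomials j) (hq.homogeneous j)
  have hB0 : ∀ j, constantCoeff (B j) = 0 := fun j => by
    rw [constantCoeff_eq]
    refine (hB j).coeff_eq_zero 0 ?_
    rw [map_zero]
    exact (hq.degree_pos j).ne
  have hX : aeval B A = X l := by
    apply hp.algebraicIndependent
    change aeval p (aeval B A) = aeval p (X l)
    rw [aeval_X, ← hAq, ← AlgHom.comp_apply, comp_aeval]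
    simp only [hBp]
  have hsum := congrArg constantCoeff (derivation_aeval (pderiv l) B A)
  rw [hX, pderiv_X_self, map_one, map_sum] at hsum
  obtain ⟨i, -, hi⟩ := Finset.exists_ne_zero_of_sum_ne_zero (hsum ▸ one_ne_zero)
  rw [map_mul] at hi
  have hi' : coeff (Finsupp.single i 1) A ≠ 0 := by
    rw [← constantCoeff_pderiv]
    intro h
    apply left_ne_zero_of_mul hi
    have h0 : (constantCoeff.comp (aeval B : _ →ₐ[ℝ] MvPolynomial (Fin m) ℝ).toRingHom) =
        (constantCoeff : MvPolynomial (Fin m) ℝ →+* ℝ) := by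
      ext j
      · simp
      · simp [hB0]
    exact (RingHom.congr_fun h0 _).trans h
  have hd := hA hi'
  rw [Finsupp.weight_single, one_smul] at hd
  exact ⟨i, A, hAq, hd ▸ hA, hi'⟩

/-- A member `p i` of an integrity basis may be replaced by a homogeneous invariant of the same
degree which contains `p i` linearly. -/
theorem update (hp : IsIntegrityBasis W k p) {i : Fin m} {A : MvPolynomial (Fin m) ℝ}
    (hA : IsWeightedHomogeneous k A (k i)) (hc : coeff (Finsupp.single i 1) A ≠ 0) :
    IsIntegrityBasis W k (Function.update p i (aeval p A)) := by
  set c := coeff (Finsupp.single i 1) A with hc_def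
  obtain ⟨B, hB, hAB⟩ := hA.exists_eq_C_mul_X_add hp.degree_pos
  rw [← hc_def] at hAB
  set p' := Function.update p i (aeval p A) with hp'
  have hcc : (C c⁻¹ * C c : MvPolynomial (Fin m) ℝ) = 1 := by
    rw [← C_mul, inv_mul_cancel₀ hc, C_1]
  have hBp : aeval p' B = aeval p B := by
    refine hom_congr_vars (f₁ := (aeval p').toRingHom) (f₂ := (aeval p).toRingHom)
      (by ext; simp) (fun j hj _ => ?_) rfl
    have hji : j ≠ i := fun h => hB (h ▸ hj)
    simp [hp', hji]
  have hpi : p i = C c⁻¹ * (p' i - aeval p' B) := by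
    rw [hBp, hp', Function.update_self]
    rw [show aeval p A = aeval p (C c * X i + B) from congrArg _ hAB]
    simp only [map_add, map_mul, aeval_X, algHom_C, algebraMap_eq, add_sub_cancel_right]
    rw [← mul_assoc, hcc, one_mul]
  refine ⟨fun j => ?_, hp.monotone, ?_, le_antisymm ?_ ?_⟩
  · rcases eq_or_ne j i with rfl | hj
    · rw [hp', Function.update_self]; exact hA.aeval_isHomogeneous hp.homogeneous
    · rw [hp', Function.update_of_ne hj]; exact hp.homogeneous j
  · -- the substitution `X i ↦ A` is injective, its left inverse being `X i ↦ c⁻¹ (X i - B)`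
    set σ : MvPolynomial (Fin m) ℝ →ₐ[ℝ] MvPolynomial (Fin m) ℝ :=
      aeval (Function.update X i A) with hσ
    set τ : MvPolynomial (Fin m) ℝ →ₐ[ℝ] MvPolynomial (Fin m) ℝ :=
      aeval (Function.update X i (C c⁻¹ * (X i - B))) with hτ
    have h1 : aeval p' = (aeval p).comp σ := by
      refine algHom_ext fun j => ?_
      rcases eq_or_ne j i with rfl | hj
      · simp [hp', hσ]
      · simp [hp', hσ, hj]
    have hτB : τ B = B := by
      have := hom_congr_vars (f₁ := τ.toRingHom) (f₂ := RingHom.id _) (p₁ := B) (p₂ := B)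
        (by ext; simp) (fun j hj _ => ?_) rfl
      · exact this
      · have hji : j ≠ i := fun h => hB (h ▸ hj)
        simp [hτ, hji]
    have h2 : Function.LeftInverse τ σ := by
      have : τ.comp σ = AlgHom.id ℝ _ := by
        refine algHom_ext fun j => ?_
        rcases eq_or_ne j i with rfl | hj
        · have : τ A = X j := by
            rw [hAB, map_add, map_mul, hτB]
            simp only [hτ, aeval_X, Function.update_self, algHom_C, algebraMap_eq]
            rw [← mul_assoc, mul_comm (C c), hcc]
            ring
          simpa [hσ] using this
        · simp [hσ, hτ, hj]
      exact fun x => AlgHom.congr_fun this x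
    rw [algebraicIndependent_iff_injective_aeval, h1, AlgHom.coe_comp]
    exact Function.Injective.comp hp.algebraicIndependent h2.injective
  · rw [Algebra.adjoin_le_iff]
    rintro _ ⟨j, rfl⟩
    rcases eq_or_ne j i with rfl | hj
    · rw [hp', Function.update_self, SetLike.mem_coe, ← hp.adjoin_eq,
        Algebra.adjoin_range_eq_range_aeval]
      exact ⟨A, rfl⟩
    · rw [hp', Function.update_of_ne hj]; exact hp.mem_invariantPolynomials j
  · rw [← hp.adjoin_eq, Algebra.adjoin_le_iff]
    rintro _ ⟨j, rfl⟩
    rcases eq_or_ne j i with rfl | hj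
    · rw [SetLike.mem_coe, hpi, Algebra.adjoin_range_eq_range_aeval]
      exact ⟨C c⁻¹ * (X j - B), by simp [algebraMap_eq]⟩
    · refine Algebra.subset_adjoin ⟨j, ?_⟩
      rw [hp', Function.update_of_ne hj]

end IsIntegrityBasis

/-! ### Powers of linear forms and averaging over the group -/

section

open MvPolynomial

/-- A linear form on Euclidean space as a polynomial. -/
noncomputable def linearPolynomial {m : ℕ} (L : Euc m →ₗ[ℝ] ℝ) : MvPolynomial (Fin m) ℝ :=
  ∑ j, C (L (EuclideanSpace.single j 1)) * X j

theorem eval_linearPolynomial {m : ℕ} (L : Euc m →ₗ[ℝ] ℝ) (x : Euc m) :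
    eval x (linearPolynomial L) = L x := by
  have hx : x = ∑ j, x j • EuclideanSpace.single j (1 : ℝ) := by
    simpa using ((EuclideanSpace.basisFun (Fin m) ℝ).sum_repr x).symm
  conv_rhs => rw [hx, map_sum]
  simp [linearPolynomial, mul_comm]

theorem isHomogeneous_linearPolynomial {m : ℕ} (L : Euc m →ₗ[ℝ] ℝ) :
    (linearPolynomial L).IsHomogeneous 1 :=
  IsHomogeneous.sum _ _ _ fun j _ => by
    simpa using (isHomogeneous_C (Fin m) (L (EuclideanSpace.single j 1))).mul (isHomogeneous_X ℝ j)

/-- Polynomials which agree as functions on Euclidean space are equal. -/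
theorem eq_of_forall_eval_euc {m : ℕ} {u v : MvPolynomial (Fin m) ℝ}
    (h : ∀ x : Euc m, eval x u = eval x v) : u = v :=
  MvPolynomial.funext fun x => h (WithLp.toLp 2 x)

/-- The `d`-th powers of linear forms span the homogeneous polynomials of degree `d`: a linear
functional which does not vanish on the latter does not vanish on the former. By the multinomial
theorem its value at the `d`-th power of the linear form with coefficients `v` is a polynomial in
`v` whose coefficients are nonzero multiples of its values at the monomials. -/
theorem exists_linearPolynomial_pow_ne_zero {m d : ℕ} (ψ : MvPolynomial (Fin m) ℝ →ₗ[ℝ] ℝ)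
    {u : MvPolynomial (Fin m) ℝ} (hu : u.IsHomogeneous d) (hψ : ψ u ≠ 0) :
    ∃ L : Euc m →ₗ[ℝ] ℝ, ψ (linearPolynomial L ^ d) ≠ 0 := by
  classical
  by_contra! h
  set Φ : MvPolynomial (Fin m) ℝ := ∑ a ∈ Finset.univ.piAntidiag d,
    monomial (Finsupp.equivFunOnFinite.symm a)
      (Nat.multinomial Finset.univ a * ψ (monomial (Finsupp.equivFunOnFinite.symm a) 1)) with hΦ
  have hmon : ∀ a : Fin m → ℕ, (monomial (Finsupp.equivFunOnFinite.symm a) 1 :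
      MvPolynomial (Fin m) ℝ) = ∏ i, X i ^ a i := fun a => by
    rw [monomial_eq, Finsupp.prod_fintype _ _ (by simp)]
    simp
  have hΦ0 : Φ = 0 := by
    refine MvPolynomial.funext fun v => ?_
    set L : Euc m →ₗ[ℝ] ℝ := ∑ i, v i • (EuclideanSpace.proj i : Euc m →L[ℝ] ℝ).toLinearMap
      with hL
    have hLv : ∀ i, L (EuclideanSpace.single i 1) = v i := fun i => by
      simp [hL]
    have hLd := h L
    rw [linearPolynomial, Finset.sum_pow_eq_sum_piAntidiag, map_sum] at hLd
    rw [map_zero, ← hLd, hΦ, map_sum]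
    refine Finset.sum_congr rfl fun a _ => ?_
    have h1 : ((Nat.multinomial Finset.univ a : MvPolynomial (Fin m) ℝ) *
        ∏ i, (C (L (EuclideanSpace.single i 1)) * X i) ^ a i) =
        (Nat.multinomial Finset.univ a * ∏ i, v i ^ a i : ℝ) •
          monomial (Finsupp.equivFunOnFinite.symm a) (1 : ℝ) := by
      rw [hmon, smul_eq_C_mul, C_mul, map_prod, map_natCast]
      simp only [hLv, mul_pow, Finset.prod_mul_distrib, map_pow, mul_assoc]
    rw [h1, map_smul, eval_monomial, Finsupp.prod_fintype _ _ (by simp), smul_eq_mul]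
    simp only [Finsupp.equivFunOnFinite_symm_apply_apply]
    ring
  have hzero : ∀ a : Fin m →₀ ℕ, a.degree = d → ψ (monomial a 1) = 0 := by
    intro a ha
    have hc : coeff a Φ = 0 := by rw [hΦ0, coeff_zero]
    have hmem : (a : Fin m → ℕ) ∈ Finset.univ.piAntidiag d := by
      rw [Finset.mem_piAntidiag]
      exact ⟨by rw [← ha, Finsupp.degree_eq_sum], by simp⟩
    rw [hΦ, coeff_sum, Finset.sum_eq_single_of_mem _ hmem] at hc
    · have he : Finsupp.equivFunOnFinite.symm (a : Fin m → ℕ) = a :=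
        Finsupp.equivFunOnFinite.symm_apply_apply a
      rw [he, coeff_monomial, if_pos rfl] at hc
      exact (mul_eq_zero.1 hc).resolve_left
        (Nat.cast_ne_zero.2 (Nat.multinomial_pos _ _).ne')
    · intro b _ hb
      rw [coeff_monomial, if_neg]
      rintro rfl
      exact hb rfl
  apply hψ
  rw [u.as_sum, map_sum]
  refine Finset.sum_eq_zero fun a ha => ?_
  rw [show monomial a (coeff a u) = coeff a u • monomial a (1 : ℝ) by simp [smul_monomial],
    map_smul, hzero a, smul_zero]
  rw [Finsupp.degree_eq_weight_one]
  exact hu (mem_support_iff.1 ha)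

/-- The precomposition of a polynomial with an orthogonal transformation. -/
noncomputable def compIsometry {m : ℕ} (g : Euc m ≃ₗᵢ[ℝ] Euc m) :
    MvPolynomial (Fin m) ℝ →ₐ[ℝ] MvPolynomial (Fin m) ℝ :=
  aeval fun i => linearPolynomial
    ((EuclideanSpace.proj i : Euc m →L[ℝ] ℝ).toLinearMap ∘ₗ (g.toLinearEquiv : Euc m →ₗ[ℝ] Euc m))

theorem eval_compIsometry {m : ℕ} (g : Euc m ≃ₗᵢ[ℝ] Euc m) (u : MvPolynomial (Fin m) ℝ)
    (x : Euc m) : eval x (compIsometry g u) = eval (g x) u := by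
  have h : (eval (x : Fin m → ℝ)).comp (compIsometry g).toRingHom =
      (eval (g x) : MvPolynomial (Fin m) ℝ →+* ℝ) := by
    ext i
    · simp [compIsometry]
    · simp [compIsometry, eval_linearPolynomial]
  exact RingHom.congr_fun h u

/-- The sum of the transforms of a polynomial under a finite group. -/
noncomputable def groupSum {m : ℕ} (W : Subgroup (Euc m ≃ₗᵢ[ℝ] Euc m)) [Fintype W] :
    MvPolynomial (Fin m) ℝ →ₗ[ℝ] MvPolynomial (Fin m) ℝ :=
  ∑ g : W, (compIsometry (g : Euc m ≃ₗᵢ[ℝ] Euc m)).toLinearMap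

section

variable {m : ℕ} (W : Subgroup (Euc m ≃ₗᵢ[ℝ] Euc m)) [Fintype W]

theorem eval_groupSum (u : MvPolynomial (Fin m) ℝ) (x : Euc m) :
    eval x (groupSum W u) = ∑ g : W, eval ((g : Euc m ≃ₗᵢ[ℝ] Euc m) x) u := by
  simp [groupSum, LinearMap.sum_apply, eval_compIsometry]

theorem groupSum_mem (u : MvPolynomial (Fin m) ℝ) : groupSum W u ∈ invariantPolynomials W := by
  intro g hg x
  rw [eval_groupSum, eval_groupSum]
  exact Fintype.sum_equiv (Equiv.mulRight (⟨g, hg⟩ : W)) _ _ fun a => rfl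

variable {W}

theorem groupSum_of_mem {u : MvPolynomial (Fin m) ℝ} (hu : u ∈ invariantPolynomials W) :
    groupSum W u = (Fintype.card W : ℝ) • u := by
  refine eq_of_forall_eval_euc fun x => ?_
  rw [eval_groupSum, smul_eval]
  simp [hu _ (Subtype.prop _) x]

end

/-- The forms obtained from a linear form by precomposition with the elements of a group. -/
noncomputable def formOrbit {m : ℕ} (W : Subgroup (Euc m ≃ₗᵢ[ℝ] Euc m)) [Fintype W]
    (L : Euc m →ₗ[ℝ] ℝ) : Finset (Euc m →ₗ[ℝ] ℝ) :=
  open Classical in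
  Finset.univ.image fun g : W => L ∘ₗ (g.1.toLinearEquiv : Euc m →ₗ[ℝ] Euc m)

section

variable {m : ℕ} (W : Subgroup (Euc m ≃ₗᵢ[ℝ] Euc m)) [Fintype W] (L : Euc m →ₗ[ℝ] ℝ)

theorem comp_mem_formOrbit {g : Euc m ≃ₗᵢ[ℝ] Euc m} (hg : g ∈ W) {M : Euc m →ₗ[ℝ] ℝ}
    (hM : M ∈ formOrbit W L) :
    M ∘ₗ (g.toLinearEquiv : Euc m →ₗ[ℝ] Euc m) ∈ formOrbit W L := by
  classical
  obtain ⟨a, -, rfl⟩ := Finset.mem_image.1 hM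
  exact Finset.mem_image.2 ⟨a * ⟨g, hg⟩, Finset.mem_univ _, rfl⟩

/-- Summing the powers of the transforms of `L` over the group, instead of over the orbit of `L`,
only introduces the order of the stabilizer of `L` as a factor. -/
theorem exists_groupSum_pow_eq (d : ℕ) :
    ∃ N : ℕ, groupSum W (linearPolynomial L ^ d) =
      (N : ℝ) • ∑ M ∈ formOrbit W L, linearPolynomial M ^ d := by
  classical
  set φ : W → (Euc m →ₗ[ℝ] ℝ) := fun g => L ∘ₗ (g.1.toLinearEquiv : Euc m →ₗ[ℝ] Euc m) with hφ
  refine ⟨({a | φ a = L} : Finset W).card, eq_of_forall_eval_euc fun x => ?_⟩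
  have hS : formOrbit W L = Finset.univ.image φ := rfl
  rw [eval_groupSum, smul_eval, map_sum, Finset.mul_sum]
  simp only [map_pow, eval_linearPolynomial]
  rw [show ∑ g : W, L (g.1 x) ^ d = ∑ g : W, (fun M : Euc m →ₗ[ℝ] ℝ => M x ^ d) (φ g) from rfl,
    Finset.sum_comp (fun M : Euc m →ₗ[ℝ] ℝ => M x ^ d) φ, hS]
  refine Finset.sum_congr rfl fun M hM => ?_
  obtain ⟨b, -, rfl⟩ := Finset.mem_image.1 hM
  rw [nsmul_eq_mul]
  congr 2
  -- the fibre of `φ` over `φ b` is a coset of the stabilizer of `L`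
  refine Finset.card_bij' (fun a _ => a * b⁻¹) (fun a _ => a * b) ?_ ?_ (by simp) (by simp)
  · intro a ha
    simp only [Finset.mem_filter, Finset.mem_univ, true_and] at ha ⊢
    ext y
    have h := LinearMap.congr_fun ha (b⁻¹.1 y)
    have hb : b.1 (b⁻¹.1 y) = y := by
      change (b * b⁻¹).1 y = y
      rw [mul_inv_cancel]; rfl
    change L (a.1 (b⁻¹.1 y)) = L (b.1 (b⁻¹.1 y)) at h
    rw [hb] at h
    exact h
  · intro a ha
    simp only [Finset.mem_filter, Finset.mem_univ, true_and] at ha ⊢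
    ext y
    exact LinearMap.congr_fun ha (b.1 y)

end

/-- A member of an integrity basis may be replaced by a sum of powers of linear forms over an orbit
of linear forms which have no common zero but the origin. -/
theorem IsIntegrityBasis.exists_update_sum_pow {m : ℕ} {W : Subgroup (Euc m ≃ₗᵢ[ℝ] Euc m)}
    (hW : IsIrreducibleReflectionGroup W) {k : Fin m → ℕ} {p : Fin m → MvPolynomial (Fin m) ℝ}
    (hp : IsIntegrityBasis W k p) (i : Fin m) :
    ∃ S : Finset (Euc m →ₗ[ℝ] ℝ),
      (∀ g ∈ W, ∀ L ∈ S, L ∘ₗ (g.toLinearEquiv : Euc m →ₗ[ℝ] Euc m) ∈ S) ∧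
      (∀ x : Euc m, (∀ L ∈ S, L x = 0) → x = 0) ∧
      IsIntegrityBasis W k (Function.update p i (∑ L ∈ S, linearPolynomial L ^ k i)) := by
  classical
  have := hW.finite
  have := Fintype.ofFinite W
  -- the coefficient of `X i` in the expression of the group sum in terms of `p`
  let toAdjoin : MvPolynomial (Fin m) ℝ →ₗ[ℝ] Algebra.adjoin ℝ (Set.range p) :=
    (groupSum W).codRestrict (Subalgebra.toSubmodule (Algebra.adjoin ℝ (Set.range p)))
      fun u => by
        rw [hp.adjoin_eq]
        exact groupSum_mem W u
  let ψ : MvPolynomial (Fin m) ℝ →ₗ[ℝ] ℝ := lcoeff ℝ (Finsupp.single i 1) ∘ₗ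
    hp.algebraicIndependent.repr.toLinearMap ∘ₗ toAdjoin
  have hψ : ∀ u A, groupSum W u = aeval p A → ψ u = coeff (Finsupp.single i 1) A := by
    intro u A h
    have h1 : hp.algebraicIndependent.repr (toAdjoin u) = A := by
      apply hp.algebraicIndependent
      change aeval p _ = aeval p A
      rw [AlgebraicIndependent.aeval_repr, ← h]
      rfl
    rw [← h1]
    rfl
  have hpi : ψ (p i) ≠ 0 := by
    rw [hψ (p i) ((Fintype.card W : ℝ) • X i)]
    · simp
    · rw [groupSum_of_mem (hp.mem_invariantPolynomials i), map_smul, aeval_X]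
  obtain ⟨L, hL⟩ := exists_linearPolynomial_pow_ne_zero ψ (hp.homogeneous i) hpi
  obtain ⟨N, hN⟩ := exists_groupSum_pow_eq W L (k i)
  set S := formOrbit W L
  have hSinv : ∑ M ∈ S, linearPolynomial M ^ k i ∈ invariantPolynomials W := by
    have hN0 : (N : ℝ) ≠ 0 := by
      intro h
      rw [h, zero_smul] at hN
      exact hL (by rw [hψ _ 0 (by rw [hN, map_zero]), coeff_zero])
    have h := Subalgebra.smul_mem _ (groupSum_mem W (linearPolynomial L ^ k i)) (N : ℝ)⁻¹
    rwa [hN, smul_smul, inv_mul_cancel₀ hN0, one_smul] at h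
  have hShom : (∑ M ∈ S, linearPolynomial M ^ k i).IsHomogeneous (k i) :=
    IsHomogeneous.sum _ _ _ fun M _ => by
      simpa using (isHomogeneous_linearPolynomial M).pow (k i)
  obtain ⟨A, hA, hAp⟩ := hp.exists_aeval_eq hSinv hShom
  have hcoeff : coeff (Finsupp.single i 1) A ≠ 0 := by
    intro h
    apply hL
    rw [hψ _ ((N : ℝ) • A) (by rw [hN, map_smul, hAp]), coeff_smul, h, smul_zero]
  refine ⟨S, fun g hg M hM => comp_mem_formOrbit W L hg hM, ?_, hAp ▸ hp.update hA hcoeff⟩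
  -- the common kernel is an invariant subspace, and it is proper since some form is nonzero
  let V : Submodule ℝ (Euc m) := ⨅ M ∈ S, LinearMap.ker M
  have hV : ∀ x, x ∈ V ↔ ∀ M ∈ S, M x = 0 := fun x => by simp [V, Submodule.mem_iInf]
  have hVinv : ∀ g ∈ W, ∀ x ∈ V, g x ∈ V := fun g hg x hx =>
    (hV _).2 fun M hM => (hV x).1 hx _ (comp_mem_formOrbit W L hg hM)
  intro x hx
  rcases hW.irreducible V hVinv with h | h
  · simpa [h] using (hV x).2 hx
  · exfalso
    apply hcoeff
    suffices A = 0 by rw [this, coeff_zero]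
    apply hp.algebraicIndependent
    change aeval p A = aeval p 0
    rw [hAp, map_zero]
    refine Finset.sum_eq_zero fun M hM => ?_
    have hM0 : linearPolynomial M = 0 := eq_of_forall_eval_euc fun y => by
      rw [eval_linearPolynomial, map_zero]
      exact (hV y).1 (h ▸ Submodule.mem_top) M hM
    rw [hM0, zero_pow (hp.degree_pos i).ne']

/-! ### The Chevalley mapping is a submersion at points with trivial stabilizer -/

theorem contDiff_eval_euc {m : ℕ} (u : MvPolynomial (Fin m) ℝ) (r : WithTop ℕ∞) :
    ContDiff ℝ r fun x : Euc m => eval x u := by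
  induction u using MvPolynomial.induction_on with
  | C a => simpa using contDiff_const
  | add a b ha hb => simpa using ha.add hb
  | mul_X a j ha =>
    simp only [map_mul, eval_X]
    exact ha.mul (contDiff_euclidean.1 contDiff_id j)

theorem contDiff_chevalleyMap {m : ℕ} (p : Fin m → MvPolynomial (Fin m) ℝ) (r : WithTop ℕ∞) :
    ContDiff ℝ r (chevalleyMap p) :=
  contDiff_euclidean.2 fun i => contDiff_eval_euc (p i) r

theorem hasFDerivAt_eval_euc {m : ℕ} (u : MvPolynomial (Fin m) ℝ) (x : Euc m) :
    HasFDerivAt (fun y : Euc m => eval y u) (fderiv ℝ (fun y : Euc m => eval y u) x) x :=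
  ((contDiff_eval_euc u 1).differentiable (by simp) x).hasFDerivAt

/-- A finite group of orthogonal transformations has a point with trivial stabilizer: the space is
not the union of the finitely many proper subspaces of points fixed by a nontrivial element. -/
theorem exists_trivial_stabilizer {m : ℕ} (W : Subgroup (Euc m ≃ₗᵢ[ℝ] Euc m)) [Finite W] :
    ∃ x : Euc m, ∀ g ∈ W, g x = x → g = 1 := by
  by_contra! h
  let V : {g : W // g ≠ 1} → Submodule ℝ (Euc m) := fun g =>
    LinearMap.ker ((g.1.1.toLinearEquiv : Euc m →ₗ[ℝ] Euc m) - LinearMap.id)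
  have hmem : ∀ g x, x ∈ V g ↔ g.1.1 x = x := fun g x => by
    simp [V, LinearMap.mem_ker, sub_eq_zero]
  have hcov : ⋃ g, (V g : Set (Euc m)) = Set.univ := by
    refine Set.eq_univ_of_forall fun x => ?_
    obtain ⟨g, hg, hgx, hg1⟩ := h x
    exact Set.mem_iUnion.2 ⟨⟨⟨g, hg⟩, fun h1 => hg1 (congrArg Subtype.val h1)⟩, (hmem _ _).2 hgx⟩
  obtain ⟨g, hg⟩ := Subspace.exists_eq_top_of_iUnion_eq_univ hcov
  apply g.2
  ext x : 2
  exact (hmem g x).1 (hg ▸ Submodule.mem_top)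

/-- At a point `x₀` with trivial stabilizer the differentials of the invariants have no common
zero `v ≠ 0`: the group sum of `⟪v, x - x₀⟫ * ∏ ‖x - g x₀‖ ^ 4`, the product being over `g ≠ 1`, is
an invariant with nonzero derivative along `v`, as the summands with `g ≠ 1` have derivative `0`
at `x₀`. -/
theorem exists_invariant_fderiv_ne_zero {m : ℕ} {W : Subgroup (Euc m ≃ₗᵢ[ℝ] Euc m)} [Finite W]
    {x₀ v : Euc m} (hx₀ : ∀ g ∈ W, g x₀ = x₀ → g = 1) (hv : v ≠ 0) :
    ∃ u ∈ invariantPolynomials W, fderiv ℝ (fun x : Euc m => eval x u) x₀ v ≠ 0 := by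
  classical
  have := Fintype.ofFinite W
  let a : MvPolynomial (Fin m) ℝ := linearPolynomial (innerSL ℝ v).toLinearMap - C (inner ℝ v x₀)
  let b : MvPolynomial (Fin m) ℝ :=
    ∏ g ∈ Finset.univ.erase (1 : W), ∑ i, (X i - C (g.1 x₀ i)) ^ 2
  have ha : ∀ x : Euc m, eval x a = inner ℝ v (x - x₀) := fun x => by
    simp [a, eval_linearPolynomial, inner_sub_right]
  have hb : ∀ x : Euc m, eval x b = ∏ g ∈ Finset.univ.erase (1 : W), ‖x - g.1 x₀‖ ^ 2 := fun x => by
    simp [b, map_prod, map_sum, EuclideanSpace.norm_sq_eq]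
  have hb1 : ∀ g : W, g ≠ 1 → eval (g.1 x₀) b = 0 := fun g hg => by
    rw [hb]
    exact Finset.prod_eq_zero (Finset.mem_erase.2 ⟨hg, Finset.mem_univ _⟩) (by simp)
  have hb0 : eval x₀ b ≠ 0 := by
    rw [hb]
    refine Finset.prod_ne_zero_iff.2 fun g hg => pow_ne_zero _ (norm_ne_zero_iff.2 ?_)
    intro h
    exact (Finset.mem_erase.1 hg).1 (Subtype.ext (hx₀ g g.2 (sub_eq_zero.1 h).symm))
  refine ⟨groupSum W (a * b ^ 2), groupSum_mem W _, ?_⟩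
  -- the derivative of `a * b ^ 2`
  have hd : ∀ x w : Euc m, fderiv ℝ (fun y : Euc m => eval y (a * b ^ 2)) x w =
      eval x b * (eval x a * (2 * fderiv ℝ (fun y : Euc m => eval y b) x w) +
        inner ℝ v w * eval x b) := by
    intro x w
    have h1 : HasFDerivAt (fun y : Euc m => eval y a) (innerSL ℝ v) x := by
      simp only [ha, inner_sub_right]
      exact (innerSL ℝ v).hasFDerivAt.sub_const _
    have h2 := h1.fun_mul ((hasFDerivAt_eval_euc b x).pow 2)
    have h3 : (fun y : Euc m => eval y (a * b ^ 2)) = fun y : Euc m => eval y a * eval y b ^ 2 :=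
      _root_.funext fun y => by rw [map_mul, map_pow]
    rw [h3, h2.fderiv]
    simp
    ring
  have hsum : HasFDerivAt (fun x : Euc m => eval x (groupSum W (a * b ^ 2)))
      (∑ g : W, (fderiv ℝ (fun y : Euc m => eval y (a * b ^ 2)) (g.1 x₀)).comp
        (g.1.toContinuousLinearEquiv : Euc m →L[ℝ] Euc m)) x₀ := by
    simp only [eval_groupSum]
    refine HasFDerivAt.fun_sum fun g _ => ?_
    exact (hasFDerivAt_eval_euc (a * b ^ 2) (g.1 x₀)).comp x₀
      (g.1.toContinuousLinearEquiv : Euc m →L[ℝ] Euc m).hasFDerivAt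
  rw [hsum.fderiv, sum_apply, Finset.sum_eq_single 1]
  · have h1 : ((1 : W).1 : Euc m ≃ₗᵢ[ℝ] Euc m) x₀ = x₀ := rfl
    have h2 : ((1 : W).1.toContinuousLinearEquiv : Euc m →L[ℝ] Euc m) v = v := rfl
    rw [ContinuousLinearMap.comp_apply, h1, h2, hd, ha]
    simpa using ⟨hb0, hv, hb0⟩
  · intro g _ hg
    rw [ContinuousLinearMap.comp_apply, hd, hb1 g hg, zero_mul]
  · simp

/-- The differential of the Chevalley mapping at a point with trivial stabilizer is injective, hence
surjective, so the mapping is open there. -/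
theorem IsIntegrityBasis.range_mem_nhds {m : ℕ} {W : Subgroup (Euc m ≃ₗᵢ[ℝ] Euc m)} [Finite W]
    {k : Fin m → ℕ} {p : Fin m → MvPolynomial (Fin m) ℝ} (hp : IsIntegrityBasis W k p)
    {x₀ : Euc m} (hx₀ : ∀ g ∈ W, g x₀ = x₀ → g = 1) :
    Set.range (chevalleyMap p) ∈ nhds (chevalleyMap p x₀) := by
  have hsd : HasStrictFDerivAt (chevalleyMap p) (fderiv ℝ (chevalleyMap p) x₀) x₀ :=
    (contDiff_chevalleyMap p 1).contDiffAt.hasStrictFDerivAt (by simp)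
  have hinj : Function.Injective (fderiv ℝ (chevalleyMap p) x₀ : Euc m →ₗ[ℝ] Euc m) := by
    rw [injective_iff_map_eq_zero]
    intro v hv
    by_contra hv0
    obtain ⟨u, hu, huv⟩ := exists_invariant_fderiv_ne_zero hx₀ hv0
    rw [← hp.adjoin_eq, Algebra.adjoin_range_eq_range_aeval] at hu
    obtain ⟨A, rfl⟩ := hu
    apply huv
    have h : (fun x : Euc m => eval x (aeval p A)) =
        (fun y : Euc m => eval y A) ∘ chevalleyMap p :=
      _root_.funext fun x => (eval_chevalleyMap p A x).symm
    have h' := (hasFDerivAt_eval_euc A (chevalleyMap p x₀)).comp x₀ hsd.hasFDerivAt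
    rw [← h] at h'
    have hv' : fderiv ℝ (chevalleyMap p) x₀ v = 0 := hv
    exact (congrArg (fun T : Euc m →L[ℝ] ℝ => T v) h'.fderiv).trans (by simp [hv'])
  have hsurj := LinearMap.injective_iff_surjective.1 hinj
  rw [← hsd.map_nhds_eq_of_surj (LinearMap.range_eq_top.2 hsurj)]
  rw [← Set.image_univ]
  exact Filter.image_mem_map Filter.univ_mem

/-! ### The function `p_n ^ (s + α)` -/

theorem contDiff_abs_rpow (s : ℕ) {β : ℝ} (hβ : (s : ℝ) < β) :
    ContDiff ℝ s fun t : ℝ => |t| ^ β := by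
  refine contDiff_of_posHomogeneous s hβ (fun x hx j => ?_) fun t ht x => ?_
  · exact (contDiffAt_abs hx).rpow_const_of_ne (abs_ne_zero.2 hx)
  · rw [smul_eq_mul, smul_eq_mul, abs_mul, abs_of_pos ht, Real.mul_rpow ht.le (abs_nonneg x)]

theorem eval_smul_of_isHomogeneous {m h : ℕ} {u : MvPolynomial (Fin m) ℝ} (hu : u.IsHomogeneous h)
    (t : ℝ) (x : Euc m) : eval (t • x) u = t ^ h * eval x u := by
  rw [eval_eq, eval_eq, Finset.mul_sum]
  refine Finset.sum_congr rfl fun a ha => ?_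
  have hd : ∑ i ∈ a.support, a i = h := by
    rw [← hu (mem_support_iff.1 ha), Finsupp.weight_apply, Finsupp.sum]
    simp
  simp only [PiLp.smul_apply, smul_eq_mul, mul_pow, Finset.prod_mul_distrib,
    Finset.prod_pow_eq_pow_sum, hd]
  ring

section

variable {m h : ℕ} {u : MvPolynomial (Fin m) ℝ}

theorem rpow_eval_smul (hu : u.IsHomogeneous h) (hu0 : ∀ x : Euc m, 0 ≤ eval x u) (β : ℝ) {t : ℝ}
    (ht : 0 < t) (x : Euc m) : eval (t • x) u ^ β = t ^ (h * β) * eval x u ^ β := by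
  rw [eval_smul_of_isHomogeneous hu, Real.mul_rpow (by positivity) (hu0 x), Real.rpow_mul ht.le,
    Real.rpow_natCast]

theorem contDiff_rpow_eval (hu : u.IsHomogeneous h) (hu0 : ∀ x : Euc m, 0 ≤ eval x u)
    (hpos : ∀ x : Euc m, x ≠ 0 → 0 < eval x u) {r : ℕ} {β : ℝ} (hr : (r : ℝ) < h * β) :
    ContDiff ℝ r fun x : Euc m => eval x u ^ β := by
  refine contDiff_of_posHomogeneous r hr (fun x hx j => ?_) fun t ht x => ?_
  · exact (contDiff_eval_euc u j).contDiffAt.rpow_const_of_ne (hpos x hx).ne'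
  · rw [rpow_eval_smul hu hu0 β ht, smul_eq_mul]

theorem ne_natCast_of_lt_of_lt {r : ℕ} {β : ℝ} (h1 : (r : ℝ) < β) (h2 : β < r + 1) (j : ℕ) :
    β ≠ j := by
  rintro rfl
  norm_cast at h1 h2
  omega

/-- On a half-line from the origin the function is a multiple of `t ^ (h * β)`. -/
theorem not_contDiffAt_rpow_eval (hu : u.IsHomogeneous h) (hu0 : ∀ x : Euc m, 0 ≤ eval x u)
    {x₁ : Euc m} (hx₁ : 0 < eval x₁ u) {r : ℕ} {β : ℝ} (hr : (r : ℝ) < h * β)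
    (hr' : h * β < r + 1) :
    ¬ ContDiffAt ℝ ((r + 1 : ℕ) : WithTop ℕ∞) (fun x : Euc m => eval x u ^ β) 0 := by
  intro hcd
  have hline : ContDiffAt ℝ ((r + 1 : ℕ) : WithTop ℕ∞) (fun t : ℝ => eval (t • x₁) u ^ β) 0 := by
    have h1 : ContDiffAt ℝ ((r + 1 : ℕ) : WithTop ℕ∞) (fun t : ℝ => t • x₁) 0 :=
      contDiffAt_id.smul contDiffAt_const
    have h2 : ContDiffAt ℝ ((r + 1 : ℕ) : WithTop ℕ∞) (fun x : Euc m => eval x u ^ β)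
        ((0 : ℝ) • x₁) := by rwa [zero_smul]
    exact h2.comp (0 : ℝ) h1
  refine not_contDiffAt_of_eqOn_mul_rpow (r + 1) (A := fun t : ℝ => t) (U := Set.Ioi 0) (e := 1)
    (K := eval x₁ u ^ β) (c := 1) (β := h * β) isOpen_Ioi (by simp) continuousAt_id rfl ?_
    (fun y hy => hy) (fun t ht => ?_) (Real.rpow_pos_of_pos hx₁ β).ne' one_ne_zero
    (by push_cast; exact hr') (fun j _ => ne_natCast_of_lt_of_lt hr hr' j) hline
  · intro y t; simp
  · rw [rpow_eval_smul hu hu0 β ht, mul_comm]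

end

section

variable {n : ℕ}

theorem contDiff_absLastPow (s : ℕ) {β : ℝ} (hβ : (s : ℝ) < β) :
    ContDiff ℝ s (absLastPow β : Euc (n + 1) → ℝ) :=
  (contDiff_abs_rpow s hβ).comp (contDiff_euclidean.1 contDiff_id (Fin.last n))

theorem not_contDiffAt_absLastPow {s : ℕ} {β : ℝ} (hβ : (s : ℝ) < β) (hβ' : β < s + 1)
    {y : Euc (n + 1)} (hy : y (Fin.last n) = 0) :
    ¬ ContDiffAt ℝ ((s + 1 : ℕ) : WithTop ℕ∞) (absLastPow β) y := by
  have hcont : Continuous fun z : Euc (n + 1) => z (Fin.last n) :=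
    (EuclideanSpace.proj (𝕜 := ℝ) (Fin.last n)).continuous
  have hline : ∀ z : Euc (n + 1), ∀ t : ℝ,
      (z + t • EuclideanSpace.single (Fin.last n) (1 : ℝ)) (Fin.last n) =
        z (Fin.last n) + 1 * t := by
    intro z t; simp
  refine not_contDiffAt_of_eqOn_mul_rpow (s + 1) (A := fun z : Euc (n + 1) => z (Fin.last n))
    (U := {z | 0 < z (Fin.last n)}) (e := EuclideanSpace.single (Fin.last n) 1) (K := 1) (c := 1)
    (β := β) (isOpen_lt continuous_const hcont) ?_ hcont.continuousAt hy hline (fun z hz => hz)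
    (fun z hz => ?_) one_ne_zero one_ne_zero (by push_cast; exact hβ')
    (fun j _ => ne_natCast_of_lt_of_lt hβ hβ' j)
  · have ht : Filter.Tendsto
        (fun t : ℝ => y + t • EuclideanSpace.single (Fin.last n) (1 : ℝ))
        (nhdsWithin 0 (Set.Ioi 0)) (nhds y) := by
      have h : Continuous fun t : ℝ => y + t • EuclideanSpace.single (Fin.last n) (1 : ℝ) := by
        fun_prop
      simpa using (h.tendsto 0).mono_left nhdsWithin_le_nhds
    refine mem_closure_of_tendsto ht ?_
    filter_upwards [self_mem_nhdsWithin] with t ht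
    rw [hline, hy]
    simpa using ht
  · have hz' : 0 < z (Fin.last n) := hz
    rw [one_mul, absLastPow, abs_of_pos hz']

end

/-- A lift of `(p l) ^ β` through the Chevalley mapping of another integrity basis `q` is equal to
`A ^ β` on the image of the mapping, where `p l = A(q)`. Some variable occurs in `A` only
linearly, and the interior of the image accumulates at the origin, where `A` vanishes. -/
theorem IsIntegrityBasis.not_exists_lift {m : ℕ} {W : Subgroup (Euc m ≃ₗᵢ[ℝ] Euc m)} [Finite W]
    {k k' : Fin m → ℕ} {p q : Fin m → MvPolynomial (Fin m) ℝ} (hp : IsIntegrityBasis W k p)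
    (hq : IsIntegrityBasis W k' q) {l : Fin m} (hpos : ∀ x : Euc m, x ≠ 0 → 0 < eval x (p l))
    {s : ℕ} {β : ℝ} (hβ : (s : ℝ) < β) (hβ' : β < s + 1) :
    ¬ ∃ G : Euc m → ℝ, ContDiff ℝ ((s + 1 : ℕ) : WithTop ℕ∞) G ∧
      ∀ x : Euc m, eval x (p l) ^ β = G (chevalleyMap q x) := by
  rintro ⟨G, hG, hfG⟩
  obtain ⟨i, A, hAq, hA, hc⟩ := hp.exists_aeval_eq_coeff_ne_zero hq l
  obtain ⟨B, hB, hAB⟩ := hA.exists_eq_C_mul_X_add hq.degree_pos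
  set c := coeff (Finsupp.single i 1) A
  have hAQ : ∀ x : Euc m, eval (chevalleyMap q x) A = eval x (p l) := fun x => by
    rw [eval_chevalleyMap, hAq]
  have hAcont : Continuous fun y : Euc m => eval y A := (contDiff_eval_euc A 0).continuous
  have hline : ∀ y : Euc m, ∀ t : ℝ,
      eval (y + t • EuclideanSpace.single i (1 : ℝ)) A = eval y A + c * t := by
    intro y t
    have h : ∀ z : Euc m, eval z A = c * z i + eval z B := fun z => by
      rw [show eval z A = eval z (C c * X i + B) from congrArg _ hAB]
      simp
    rw [h, h, eval_add_single_of_notMem_vars hB]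
    simp
    ring
  obtain ⟨x₀, hx₀⟩ := exists_trivial_stabilizer W
  -- a point with trivial stabilizer may be moved off the origin
  obtain ⟨x₁, hx₁, hx₁0⟩ : ∃ x₁ : Euc m, (∀ g ∈ W, g x₁ = x₁ → g = 1) ∧ x₁ ≠ 0 := by
    rcases eq_or_ne x₀ 0 with rfl | h
    · exact ⟨EuclideanSpace.single i 1, fun g hg _ => hx₀ g hg (map_zero g), by simp⟩
    · exact ⟨x₀, hx₀, h⟩
  refine not_contDiffAt_of_eqOn_mul_rpow (s + 1) (A := fun y : Euc m => eval y A)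
    (U := interior (Set.range (chevalleyMap q)) ∩ {y | 0 < eval y A}) (y₀ := chevalleyMap q 0)
    (e := EuclideanSpace.single i 1) (K := 1) (c := c) (β := β)
    (isOpen_interior.inter (isOpen_lt continuous_const hAcont)) ?_ hAcont.continuousAt ?_ hline
    (fun y hy => hy.2) ?_ one_ne_zero hc (by push_cast; exact hβ')
    (fun j _ => ne_natCast_of_lt_of_lt hβ hβ' j) hG.contDiffAt
  · have ht : Filter.Tendsto (fun t : ℝ => chevalleyMap q (t • x₁))
        (nhdsWithin 0 (Set.Ioi 0)) (nhds (chevalleyMap q 0)) := by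
      have h : Continuous fun t : ℝ => chevalleyMap q (t • x₁) :=
        (contDiff_chevalleyMap q 0).continuous.comp (by fun_prop)
      simpa using (h.tendsto 0).mono_left nhdsWithin_le_nhds
    refine mem_closure_of_tendsto ht ?_
    filter_upwards [self_mem_nhdsWithin] with t ht
    have ht0 : t ≠ 0 := (Set.mem_Ioi.1 ht).ne'
    refine ⟨mem_interior_iff_mem_nhds.2 (hq.range_mem_nhds fun g hg hgt => hx₁ g hg ?_), ?_⟩
    · rw [map_smul] at hgt
      exact smul_right_injective _ ht0 hgt
    · change 0 < eval (chevalleyMap q (t • x₁)) A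
      rw [hAQ]
      exact hpos _ (smul_ne_zero ht0 hx₁0)
  · have h := eval_smul_of_isHomogeneous (hp.homogeneous l) 0 0
    rwa [zero_smul, zero_pow (hp.degree_pos l).ne', zero_mul, ← hAQ] at h
  · rintro y ⟨hy, -⟩
    obtain ⟨x, rfl⟩ := interior_subset hy
    rw [one_mul, ← hfG, ← hAQ]

end

theorem mainTheorem2 (n : ℕ) (W : Subgroup (Euc (n + 1) ≃ₗᵢ[ℝ] Euc (n + 1)))
    (hW : IsIrreducibleReflectionGroup W)
    (k : Fin (n + 1) → ℕ) (p₀ : Fin (n + 1) → MvPolynomial (Fin (n + 1)) ℝ)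
    (hp₀ : IsIntegrityBasis W k p₀) (heven : Even (k (Fin.last n))) :
    -- a basis whose last member is a sum of powers of linear forms, positive off the origin
    (∃ p : Fin (n + 1) → MvPolynomial (Fin (n + 1)) ℝ, IsIntegrityBasis W k p ∧
      (∃ S : Finset (Euc (n + 1) →ₗ[ℝ] ℝ),
        (∀ g ∈ W, ∀ L ∈ S, L ∘ₗ (g.toLinearEquiv : Euc (n + 1) →ₗ[ℝ] Euc (n + 1)) ∈ S) ∧
        (∀ x : Euc (n + 1), (∀ L ∈ S, L x = 0) → x = 0) ∧
        ∀ x : Euc (n + 1),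
          MvPolynomial.eval x (p (Fin.last n)) = ∑ L ∈ S, L x ^ k (Fin.last n)) ∧
      ∀ x : Euc (n + 1), x ≠ 0 → 0 < MvPolynomial.eval x (p (Fin.last n))) ∧
    -- the counterexample, for every basis whose last member is positive off the origin
    ∀ p : Fin (n + 1) → MvPolynomial (Fin (n + 1)) ℝ, IsIntegrityBasis W k p →
      (∀ x : Euc (n + 1), x ≠ 0 → 0 < MvPolynomial.eval x (p (Fin.last n))) →
      ∀ (s : ℕ) (α : ℝ), 0 < α → α < 1 / (k (Fin.last n) : ℝ) →
      ∀ (F f : Euc (n + 1) → ℝ), F = absLastPow ((s : ℝ) + α) → f = F ∘ chevalleyMap p →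
        ContDiff ℝ (s : ℕ) F ∧
        (∀ y : Euc (n + 1), y (Fin.last n) = 0 → ¬ ContDiffAt ℝ ((s + 1 : ℕ) : WithTop ℕ∞) F y) ∧
        (∀ x, f x = MvPolynomial.eval x (p (Fin.last n)) ^ ((s : ℝ) + α)) ∧
        (∀ g ∈ W, ∀ x, f (g x) = f x) ∧
        ContDiff ℝ ((k (Fin.last n) * s : ℕ) : WithTop ℕ∞) f ∧
        ¬ ContDiffAt ℝ ((k (Fin.last n) * s + 1 : ℕ) : WithTop ℕ∞) f 0 ∧
        -- no function of class `C^(s+1)` lifts `f`, whatever integrity basis is used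
        ∀ (k' : Fin (n + 1) → ℕ) (q : Fin (n + 1) → MvPolynomial (Fin (n + 1)) ℝ),
          IsIntegrityBasis W k' q →
          ¬ ∃ G : Euc (n + 1) → ℝ,
            ContDiff ℝ ((s + 1 : ℕ) : WithTop ℕ∞) G ∧ f = G ∘ chevalleyMap q := by
  obtain ⟨S, hSW, hS0, hSb⟩ := hp₀.exists_update_sum_pow hW (Fin.last n)
  have hSeval : ∀ x : Euc (n + 1), MvPolynomial.eval x (Function.update p₀ (Fin.last n)
      (∑ L ∈ S, linearPolynomial L ^ k (Fin.last n)) (Fin.last n)) =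
        ∑ L ∈ S, L x ^ k (Fin.last n) := fun x => by
    simp [eval_linearPolynomial]
  refine ⟨⟨_, hSb, ⟨S, hSW, hS0, hSeval⟩, fun x hx => ?_⟩, ?_⟩
  · rw [hSeval]
    refine Finset.sum_pos' (fun L _ => heven.pow_nonneg _) ?_
    by_contra! h
    refine hx (hS0 x fun L hL => ?_)
    by_contra hLx
    exact (heven.pow_pos hLx).not_ge (h L hL)
  · rintro p hp hpos s α hα hαh F f rfl rfl
    have hfin := hW.finite
    set h := k (Fin.last n)
    have hh : 0 < h := hp.degree_pos _
    have hh1 : (1 : ℝ) ≤ h := by exact_mod_cast hh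
    have hhα : h * α < 1 := by
      rwa [lt_div_iff₀ (by linarith), mul_comm] at hαh
    have hα1 : α < 1 := by nlinarith
    have hhom := hp.homogeneous (Fin.last n)
    have hnonneg : ∀ x : Euc (n + 1), 0 ≤ MvPolynomial.eval x (p (Fin.last n)) := fun x => by
      rcases eq_or_ne x 0 with rfl | hx
      · have h0 := eval_smul_of_isHomogeneous hhom 0 0
        rw [zero_smul, zero_pow hh.ne', zero_mul] at h0
        exact h0.ge
      · exact (hpos x hx).le
    have hf : ∀ x, (absLastPow ((s : ℝ) + α) ∘ chevalleyMap p) x =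
        MvPolynomial.eval x (p (Fin.last n)) ^ ((s : ℝ) + α) := fun x =>
      congrArg (· ^ ((s : ℝ) + α)) (abs_of_nonneg (hnonneg x))
    have hf' := _root_.funext hf
    have hlow : ((h * s : ℕ) : ℝ) < h * (s + α) := by
      push_cast
      nlinarith
    have hupp : h * (s + α) < ((h * s : ℕ) : ℝ) + 1 := by
      push_cast
      linarith
    refine ⟨contDiff_absLastPow s (by linarith),
      fun y hy => not_contDiffAt_absLastPow (by linarith) (by linarith) hy, hf, ?_, ?_, ?_, ?_⟩
    · intro g hg x
      rw [hf, hf, hp.mem_invariantPolynomials _ g hg x]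
    · rw [hf']
      exact contDiff_rpow_eval hhom hnonneg hpos hlow
    · rw [hf']
      exact not_contDiffAt_rpow_eval hhom hnonneg
        (hpos (EuclideanSpace.single (Fin.last n) 1) (by simp)) hlow hupp
    · rintro k' q hq ⟨G, hG, hfG⟩
      exact hp.not_exists_lift hq hpos (s := s) (β := s + α) (by linarith) (by linarith)
        ⟨G, hG, fun x => by rw [← hf, hfG, Function.comp_apply]⟩
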